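/- Let $f\!p(\pi)$ denote the number of fixed points of a permutation $\pi$. A permutation $\pi$ of $[n]=\{1,\dots,n\}$ contains a pattern $\tau\in S_k$ if there are positions $i_1<\cdots<i_k$ such that $(\pi(i_1),\dots,\pi(i_k))$ has the same relative order as $(\tau(1),\dots,\tau(k))$; otherwise $\pi$ avoids $\tau$. Let $\mathbf{Iv}_n(\tau)$ be the set of permutations $\pi$ of $[n]$ with $\pi^{-1}=\pi$ that avoid $\tau$. Fix $\tau\in\{231,312\}$ (in one-line notation) and, for each $n$, let $\Pi_n$ be a uniformly random element of $\mathbf{Iv}_n(\tau)$. Then, as $n\to\infty$, $$\mathbb{E}\big(f\!p(\Pi_n)\big)=\frac n3+O(1),\qquad \operatorname{Var}\big(f\!p(\Pi_n)\big)=\frac{8}{27}\,n+O(1),$$ and $$\frac{f\!p(\Pi_n)-\frac n3}{\sqrt{8n/27}}\;\longrightarrow_d\; Z,$$ where $Z$ is a standard normal random variable and $\longrightarrow_d$ denotes convergence in distribution. -/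

import Mathlib

open MeasureTheory ProbabilityTheory Filter

/-- The permutation with one-line notation `2 3 1`; positions and values are counted from `0`. -/
def perm231 : Equiv.Perm (Fin 3) where
  toFun := ![1, 2, 0]
  invFun := ![2, 0, 1]
  left_inv := by decide
  right_inv := by decide

/-- The permutation with one-line notation `3 1 2`; positions and values are counted from `0`. -/
def perm312 : Equiv.Perm (Fin 3) where
  toFun := ![2, 0, 1]
  invFun := ![1, 2, 0]
  left_inv := by decide
  right_inv := by decide

/-- `π` contains the pattern `τ`: at some positions `i 0 < i 1 < ⋯ < i (k - 1)` the values of `π`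
are in the same relative order as the values of `τ`. -/
def ContainsPattern {k n : ℕ} (τ : Equiv.Perm (Fin k)) (π : Equiv.Perm (Fin n)) : Prop :=
  ∃ i : Fin k → Fin n, StrictMono i ∧ ∀ a b : Fin k, π (i a) < π (i b) ↔ τ a < τ b

/-- The set of involutions of an `n`-element linear order that avoid the pattern `τ`
(the identity is an involution). -/
def avoidingInvolutions {k : ℕ} (τ : Equiv.Perm (Fin k)) (n : ℕ) : Set (Equiv.Perm (Fin n)) :=
  {π | π⁻¹ = π ∧ ¬ ContainsPattern τ π}

/-- The number of fixed points of a permutation. -/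
def numFixedPoints {n : ℕ} (π : Equiv.Perm (Fin n)) : ℕ :=
  (Finset.univ.filter fun j : Fin n => π j = j).card

/-- Every set of permutations is an event. -/
instance permMeasurableSpace (n : ℕ) : MeasurableSpace (Equiv.Perm (Fin n)) := ⊤

/-! A 231-avoiding involution is layered: with `a = p (n - 1)` it reverses `{a, …, n - 1}` and
restricts to a 231-avoiding involution below `a`. Such involutions thus correspond to compositions
of `n`, and fixed points to odd parts. The generating function `F_n(x)` of fixed points satisfies
`F_{n+3} = x F_{n+2} + 2 F_{n+1}` (`fixSum_add_three`).

At `x = 1` the characteristic roots are 2 and -1; there are `2 ^ (n - 1)` involutions for `n ≥ 1`,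
and the first two moments have closed forms. At `x = exp (s * I)` the dominant root, divided by `2 *
exp (s * I / 3)`, is `1 - (4/27) s² + o(s²)` (`exists_normalizedRoot_sub_one_eq`). With `s` of order
`n ^ (-1/2)` its `n`-th power tends to the Gaussian characteristic function, and Lévy's continuity
theorem concludes. -/

/-! ### Layered structure of 231-avoiding involutions -/

/-- `p` is an involution of `ℕ` which is the identity from `n` on and avoids the pattern `231`. -/
def IsLayered (n : ℕ) (p : ℕ → ℕ) : Prop :=
  (∀ i, p (p i) = i) ∧ (∀ i, n ≤ i → p i = i) ∧
    ∀ i j k, i < j → j < k → ¬ (p k < p i ∧ p i < p j)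

namespace IsLayered

variable {n : ℕ} {p : ℕ → ℕ}

lemma apply_lt (h : IsLayered n p) {i : ℕ} (hi : i < n) : p i < n := by
  by_contra! hc
  have h1 := h.2.1 _ hc
  have h2 := h.1 i
  omega

/-- Otherwise the positions `p i < p (n - 1) < n - 1` carry the values `i`, `n - 1`, `p (n - 1)`, a
231. -/
lemma lt_apply_of_mem_block (h : IsLayered n p) {i : ℕ} (h1 : p (n - 1) < i) (h2 : i < n - 1) :
    p (n - 1) < p i := by
  have ha := h.1 (n - 1)
  have hi := h.1 i
  by_contra! hc
  rcases hc.lt_or_eq with hc | hc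
  · refine h.2.2 (p i) (p (n - 1)) (n - 1) hc (by omega) ?_
    rw [ha, hi]
    exact ⟨h1, h2⟩
  · have := congrArg p hc
    omega

/-- On the block `p` is strictly decreasing, so `p i + i` is nonincreasing; it takes the same value
at both ends, hence is constant. -/
lemma apply_add_eq_of_mem_block (h : IsLayered n p) :
    ∀ d i, p (n - 1) + d = i → i < n → p i + i = p (n - 1) + (n - 1) := by
  have ha := h.1 (n - 1)
  have inj : ∀ i j, p i = p j → i = j := fun i j hij => by
    have := congrArg p hij
    rwa [h.1, h.1] at this
  have anti : ∀ i j, p (n - 1) ≤ i → i < j → j < n → p j < p i := by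
    intro i j hi hij hj
    by_contra! hc
    have hne : p i ≠ p j := fun e => by have := inj _ _ e; omega
    have hlt : p i < p j := by omega
    rcases Nat.lt_or_ge (p (n - 1)) i with h1 | h1
    · have h2 := h.lt_apply_of_mem_block h1 (by omega)
      rcases Nat.lt_or_ge j (n - 1) with h3 | h3
      · exact h.2.2 i j (n - 1) hij h3 ⟨h2, hlt⟩
      · have : j = n - 1 := by omega
        subst this
        omega
    · have : i = p (n - 1) := by omega
      subst this
      have := h.apply_lt hj
      omega
  have up : ∀ d i, p (n - 1) + d = i → i < n → p i + i ≤ p (n - 1) + (n - 1) := by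
    intro d
    induction d with
    | zero => intro i hi hn; subst hi; simp only [Nat.add_zero, ha]; omega
    | succ d ih =>
      intro i hi hn
      have h1 := ih (i - 1) (by omega) (by omega)
      have h2 := anti (i - 1) i (by omega) (by omega) hn
      omega
  have down : ∀ d i, i + d = n - 1 → p (n - 1) ≤ i → i < n →
      p (n - 1) + (n - 1) ≤ p i + i := by
    intro d
    induction d with
    | zero => intro i hi _ _; have : i = n - 1 := by omega
              subst this; omega
    | succ d ih =>
      intro i hi h0 hn
      have h1 := ih (i + 1) (by omega) (by omega) (by omega)
      have h2 := anti i (i + 1) h0 (by omega) (by omega)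
      omega
  intro d i hd hi
  exact le_antisymm (up d i hd hi) (down (n - 1 - i) i (by omega) (by omega) hi)

lemma apply_of_mem_block (h : IsLayered n p) {i : ℕ} (h1 : p (n - 1) ≤ i) (h2 : i < n) :
    p i = p (n - 1) + n - 1 - i := by
  have := h.apply_add_eq_of_mem_block (i - p (n - 1)) i (by omega) h2
  omega

end IsLayered

/-- Replace `p` by the identity from `a` on. -/
def truncateAt (a : ℕ) (p : ℕ → ℕ) (i : ℕ) : ℕ := if i < a then p i else i

/-- Append to an involution of `{0, …, a - 1}` the block which reverses `{a, …, n - 1}`. -/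
def appendBlock (a n : ℕ) (q : ℕ → ℕ) (i : ℕ) : ℕ :=
  if i < a then q i else if i < n then a + n - 1 - i else i

lemma IsLayered.truncateAt {n : ℕ} {p : ℕ → ℕ} (h : IsLayered n p) (hn : 0 < n) :
    IsLayered (p (n - 1)) (truncateAt (p (n - 1)) p) := by
  -- The last block is mapped to itself, so its complement is too.
  have hlt : ∀ i, i < p (n - 1) → p i < p (n - 1) := by
    intro i hi
    by_contra! hc
    have h1 := h.apply_lt (i := n - 1) (by omega)
    have h2 := h.apply_of_mem_block hc (h.apply_lt (by omega))
    have h3 := h.1 i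
    have h4 := h.apply_lt (i := i) (by omega)
    omega
  refine ⟨fun i => ?_, fun i hi => ?_, fun i j k hij hjk => ?_⟩
  · by_cases hi : i < p (n - 1)
    · simp [_root_.truncateAt, hi, hlt i hi, h.1]
    · simp [_root_.truncateAt, hi]
  · simp [_root_.truncateAt, Nat.not_lt.2 hi]
  · have h1 := h.2.2 i j k hij hjk
    have h2 := hlt i
    have h3 := hlt j
    have h4 := hlt k
    simp only [_root_.truncateAt]
    split_ifs <;> omega

lemma IsLayered.appendBlock {a n : ℕ} {q : ℕ → ℕ} (h : IsLayered a q) (han : a < n) :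
    IsLayered n (appendBlock a n q) := by
  refine ⟨fun i => ?_, fun i hi => ?_, fun i j k hij hjk => ?_⟩
  · have h1 := h.1 i
    have h2 := @IsLayered.apply_lt _ _ h i
    simp only [_root_.appendBlock]
    split_ifs <;> omega
  · simp only [_root_.appendBlock]
    split_ifs <;> omega
  · have h1 := h.2.2 i j k hij hjk
    have h2 := @IsLayered.apply_lt _ _ h i
    have h3 := @IsLayered.apply_lt _ _ h j
    have h4 := @IsLayered.apply_lt _ _ h k
    simp only [_root_.appendBlock]
    split_ifs <;> omega

lemma truncateAt_appendBlock {a n : ℕ} {q : ℕ → ℕ} (h : IsLayered a q) :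
    truncateAt a (appendBlock a n q) = q := by
  funext i
  by_cases hi : i < a
  · simp [truncateAt, appendBlock, hi]
  · simp [truncateAt, hi, h.2.1 i (by omega)]

lemma appendBlock_truncateAt {n : ℕ} {p : ℕ → ℕ} (h : IsLayered n p) :
    appendBlock (p (n - 1)) n (truncateAt (p (n - 1)) p) = p := by
  funext i
  have h1 := @IsLayered.apply_of_mem_block _ _ h i
  have h2 := h.2.1 i
  simp only [truncateAt, appendBlock]
  split_ifs <;> omega

lemma appendBlock_last {a n : ℕ} (q : ℕ → ℕ) (han : a < n) : appendBlock a n q (n - 1) = a := by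
  simp only [appendBlock]
  split_ifs <;> omega

/-! ### Fixed points and odd blocks -/

/-- The number of fixed points of `p` below `n`. -/
def fixCount (n : ℕ) (p : ℕ → ℕ) : ℕ := ((Finset.range n).filter fun i => p i = i).card

lemma card_filter_eq_reverse (m : ℕ) :
    ((Finset.range m).filter fun i => m - 1 - i = i).card = m % 2 := by
  rcases Nat.even_or_odd' m with ⟨k, rfl | rfl⟩
  · rw [Finset.filter_eq_empty_iff.2]
    · simp
    · intro i hi
      have := Finset.mem_range.1 hi
      omega
  · rw [show (Finset.range (2 * k + 1)).filter (fun i => 2 * k + 1 - 1 - i = i) = {k} from ?_]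
    · simp
    · ext i
      simp only [Finset.mem_filter, Finset.mem_range, Finset.mem_singleton]
      omega

lemma fixCount_appendBlock {a n : ℕ} (q : ℕ → ℕ) (han : a < n) :
    fixCount n (appendBlock a n q) = fixCount a q + (n - a) % 2 := by
  obtain ⟨m, rfl⟩ := Nat.exists_eq_add_of_lt han
  rw [← card_filter_eq_reverse]
  simp only [fixCount, Finset.card_filter]
  rw [show a + m + 1 = a + (m + 1) by ring, Finset.sum_range_add]
  congr 1
  · refine Finset.sum_congr rfl fun i hi => ?_
    simp [appendBlock, Finset.mem_range.1 hi]
  · rw [Nat.add_sub_cancel_left]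
    refine Finset.sum_congr rfl fun i hi => ?_
    have := Finset.mem_range.1 hi
    congr 1
    simp only [appendBlock, eq_iff_iff]
    split_ifs <;> omega

/-! ### Transfer from permutations of `Fin n` to maps on `ℕ` -/

/-- The extension of a permutation of `Fin n` to `ℕ` by the identity. -/
def extendPerm {n : ℕ} (π : Equiv.Perm (Fin n)) (i : ℕ) : ℕ := if h : i < n then π ⟨i, h⟩ else i

lemma extendPerm_val {n : ℕ} (π : Equiv.Perm (Fin n)) (i : Fin n) :
    extendPerm π i = π i := by
  simp [extendPerm]

lemma extendPerm_injective {n : ℕ} :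
    Function.Injective (extendPerm : Equiv.Perm (Fin n) → ℕ → ℕ) := by
  intro π σ h
  ext i
  rw [← extendPerm_val, ← extendPerm_val, h]

lemma fixCount_extendPerm {n : ℕ} (π : Equiv.Perm (Fin n)) :
    fixCount n (extendPerm π) = numFixedPoints π := by
  simp only [fixCount, numFixedPoints, Finset.card_filter, ← Fin.sum_univ_eq_sum_range
    (fun i => if extendPerm π i = i then 1 else 0) n, extendPerm_val, Fin.val_inj]

lemma containsPattern_perm231_iff {n : ℕ} (π : Equiv.Perm (Fin n)) :
    ContainsPattern perm231 π ↔ ∃ i j k, i < j ∧ j < k ∧ π k < π i ∧ π i < π j := by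
  constructor
  · rintro ⟨i, hi, h⟩
    exact ⟨i 0, i 1, i 2, hi (by decide), hi (by decide), (h 2 0).2 (by decide),
      (h 0 1).2 (by decide)⟩
  · rintro ⟨i, j, k, hij, hjk, h1, h2⟩
    refine ⟨![i, j, k], ?_, ?_⟩
    · rw [Fin.strictMono_iff_lt_succ]
      intro a
      fin_cases a <;> simpa
    · intro a b
      have h3 := h1.trans h2
      fin_cases a <;> fin_cases b <;>
        simp [perm231, h1, h2, h3, h1.le, h2.le, h3.le]

lemma containsPattern_perm312_iff {n : ℕ} (π : Equiv.Perm (Fin n)) :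
    ContainsPattern perm312 π ↔ ∃ i j k, i < j ∧ j < k ∧ π j < π k ∧ π k < π i := by
  constructor
  · rintro ⟨i, hi, h⟩
    exact ⟨i 0, i 1, i 2, hi (by decide), hi (by decide), (h 1 2).2 (by decide),
      (h 2 0).2 (by decide)⟩
  · rintro ⟨i, j, k, hij, hjk, h1, h2⟩
    refine ⟨![i, j, k], ?_, ?_⟩
    · rw [Fin.strictMono_iff_lt_succ]
      intro a
      fin_cases a <;> simpa
    · intro a b
      have h3 := h1.trans h2
      fin_cases a <;> fin_cases b <;>
        simp [perm312, h1, h2, h3, h1.le, h2.le, h3.le]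

/-- The patterns are mutually inverse, and inversion exchanges positions with values while fixing
each involution. -/
lemma avoidingInvolutions_perm312 (n : ℕ) :
    avoidingInvolutions perm312 n = avoidingInvolutions perm231 n := by
  ext π
  refine and_congr_right fun hπ => not_congr ?_
  have hinv : ∀ i, π (π i) = i := fun i => by
    nth_rewrite 1 [← hπ]
    simp
  rw [containsPattern_perm231_iff, containsPattern_perm312_iff]
  constructor
  · rintro ⟨i, j, k, hij, hjk, h1, h2⟩
    exact ⟨π j, π k, π i, h1, h2, by rwa [hinv, hinv], by rwa [hinv, hinv]⟩
  · rintro ⟨i, j, k, hij, hjk, h1, h2⟩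
    exact ⟨π k, π i, π j, h1, h2, by rwa [hinv, hinv], by rwa [hinv, hinv]⟩

lemma image_extendPerm_avoidingInvolutions (n : ℕ) :
    extendPerm '' avoidingInvolutions perm231 n = {p | IsLayered n p} := by
  ext p
  constructor
  · rintro ⟨π, ⟨hπ, hav⟩, rfl⟩
    have hinv : ∀ i, π (π i) = i := fun i => by
      nth_rewrite 1 [← hπ]
      simp
    rw [containsPattern_perm231_iff] at hav
    refine ⟨fun i => ?_, fun i hi => ?_, ?_⟩
    · by_cases hi : i < n
      · have := extendPerm_val π (π ⟨i, hi⟩)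
        rw [hinv] at this
        rwa [show extendPerm π i = π ⟨i, hi⟩ from extendPerm_val π ⟨i, hi⟩]
      · simp [extendPerm, hi]
    · simp [extendPerm, Nat.not_lt.2 hi]
    · intro i j k hij hjk hc
      by_cases hk : k < n
      · have hj := hjk.trans hk
        have hi := hij.trans hj
        simp only [extendPerm, hi, hj, hk, dif_pos] at hc
        exact hav ⟨⟨i, hi⟩, ⟨j, hj⟩, ⟨k, hk⟩, hij, hjk, hc⟩
      · have hi : i < n := by
          by_contra hi
          simp only [extendPerm, hk, hi, dif_neg, not_false_eq_true] at hc
          omega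
        simp only [extendPerm, hk, hi, dif_neg, dif_pos, not_false_eq_true] at hc
        have := (π ⟨i, hi⟩).2
        omega
  · intro hp
    let f : Fin n → Fin n := fun i => ⟨p i, hp.apply_lt i.2⟩
    have hf : Function.Involutive f := fun i => Fin.ext (hp.1 i)
    refine ⟨hf.toPerm f, ⟨?_, ?_⟩, ?_⟩
    · exact hf.toPerm_symm
    · rw [containsPattern_perm231_iff]
      rintro ⟨i, j, k, hij, hjk, h⟩
      exact hp.2.2 i j k hij hjk h
    · funext i
      by_cases hi : i < n
      · exact extendPerm_val (hf.toPerm f) ⟨i, hi⟩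
      · simp [extendPerm, hi, hp.2.1 i (by omega)]

lemma finite_isLayered (n : ℕ) : {p | IsLayered n p}.Finite := by
  rw [← image_extendPerm_avoidingInvolutions]
  exact (Set.toFinite _).image _

/-! ### Recurrence for sums over fixed-point counts -/

/-- The finite set of layered involutions of `{0, …, n - 1}`. -/
noncomputable def layered (n : ℕ) : Finset (ℕ → ℕ) := (finite_isLayered n).toFinset

lemma mem_layered {n : ℕ} {p : ℕ → ℕ} : p ∈ layered n ↔ IsLayered n p := by
  simp [layered]

lemma sum_layered_eq_sum_appendBlock {M : Type*} [AddCommMonoid M] {n : ℕ} (hn : 0 < n)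
    (G : (ℕ → ℕ) → M) :
    ∑ p ∈ layered n, G p =
      ∑ a ∈ Finset.range n, ∑ q ∈ layered a, G (appendBlock a n q) := by
  rw [Finset.sum_sigma']
  refine Finset.sum_bij' (fun p _ => ⟨p (n - 1), truncateAt (p (n - 1)) p⟩)
    (fun x _ => appendBlock x.1 n x.2) ?_ ?_ ?_ ?_ ?_
  · intro p hp
    rw [mem_layered] at hp
    simp only [Finset.mem_sigma, Finset.mem_range, mem_layered]
    exact ⟨hp.apply_lt (by omega), hp.truncateAt hn⟩
  · rintro ⟨a, q⟩ hx
    simp only [Finset.mem_sigma, Finset.mem_range, mem_layered] at hx ⊢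
    exact hx.2.appendBlock hx.1
  · intro p hp
    exact appendBlock_truncateAt (mem_layered.1 hp)
  · rintro ⟨a, q⟩ hx
    simp only [Finset.mem_sigma, Finset.mem_range, mem_layered] at hx
    simp only [appendBlock_last q hx.1, truncateAt_appendBlock hx.2]
  · intro p hp
    rw [appendBlock_truncateAt (mem_layered.1 hp)]

/-- The sum of `g` over the numbers of fixed points of the layered involutions. -/
noncomputable def fixSum {M : Type*} [AddCommMonoid M] (n : ℕ) (g : ℕ → M) : M :=
  ∑ p ∈ layered n, g (fixCount n p)

section fixSum

variable {M : Type*} [AddCommMonoid M]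

lemma fixSum_zero (g : ℕ → M) : fixSum 0 g = g 0 := by
  have : layered 0 = {id} := by
    ext p
    rw [mem_layered, Finset.mem_singleton]
    constructor
    · intro h
      funext i
      exact h.2.1 i (Nat.zero_le i)
    · rintro rfl
      exact ⟨fun _ => rfl, fun _ _ => rfl, fun i j k hij hjk => by simp only [id]; omega⟩
  simp [fixSum, this, fixCount]

lemma fixSum_eq_sum_range {n : ℕ} (hn : 0 < n) (g : ℕ → M) :
    fixSum n g = ∑ a ∈ Finset.range n, fixSum a fun k => g (k + (n - a) % 2) := by
  rw [fixSum, sum_layered_eq_sum_appendBlock hn]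
  refine Finset.sum_congr rfl fun a ha => Finset.sum_congr rfl fun q _ => ?_
  rw [fixCount_appendBlock q (Finset.mem_range.1 ha)]

lemma fixSum_one (g : ℕ → M) : fixSum 1 g = g 1 := by
  simp [fixSum_eq_sum_range, fixSum_zero]

lemma fixSum_two (g : ℕ → M) : fixSum 2 g = g 2 + g 0 := by
  simp [fixSum_eq_sum_range (n := 2), Finset.sum_range_succ, fixSum_zero, fixSum_one, add_comm]

/-- A last block of size 1 gives the shifted term and one of size 2 gives one copy of `fixSum (n +
1) g`. Shortening a larger last block by 2 keeps its parity and gives the second copy. The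
recurrence fails one step earlier, because size 0 has no last block to shorten. -/
lemma fixSum_add_three (n : ℕ) (g : ℕ → M) :
    fixSum (n + 3) g = fixSum (n + 2) (fun k => g (k + 1)) + 2 • fixSum (n + 1) g := by
  rw [fixSum_eq_sum_range (by omega), Finset.sum_range_succ, Finset.sum_range_succ]
  have h : ∑ a ∈ Finset.range (n + 1), fixSum a (fun k => g (k + (n + 3 - a) % 2)) =
      fixSum (n + 1) g := by
    rw [fixSum_eq_sum_range (n := n + 1) (by omega)]
    refine Finset.sum_congr rfl fun a ha => ?_
    have := Finset.mem_range.1 ha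
    rw [show (n + 3 - a) % 2 = (n + 1 - a) % 2 by omega]
  rw [h, show (n + 3 - (n + 1)) % 2 = 0 by omega, show (n + 3 - (n + 2)) % 2 = 1 by omega, two_nsmul]
  simp only [add_zero]
  abel

end fixSum

lemma sum_avoidingInvolutions {M : Type*} [AddCommMonoid M] {τ : Equiv.Perm (Fin 3)}
    (hτ : τ = perm231 ∨ τ = perm312) (n : ℕ) (g : ℕ → M) :
    ∑ π ∈ (Set.toFinite (avoidingInvolutions τ n)).toFinset, g (numFixedPoints π) =
      fixSum n g := by
  classical
  have hS : avoidingInvolutions τ n = avoidingInvolutions perm231 n := by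
    rcases hτ with rfl | rfl
    · rfl
    · exact avoidingInvolutions_perm312 n
  have : layered n = (Set.toFinite (avoidingInvolutions τ n)).toFinset.image extendPerm := by
    ext p
    rw [mem_layered, ← Finset.mem_coe, Finset.coe_image, Set.Finite.coe_toFinset, hS,
      image_extendPerm_avoidingInvolutions]
    rfl
  rw [fixSum, this, Finset.sum_image extendPerm_injective.injOn]
  simp only [fixCount_extendPerm]

/-! ### Closed forms for the count and the first two moments -/

lemma fixSum_const_one (m : ℕ) : fixSum (m + 1) (fun _ => (1 : ℝ)) = 2 ^ m := by
  induction m using Nat.twoStepInduction with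
  | zero => simp [fixSum_one]
  | one => norm_num [fixSum_two]
  | more m h0 h1 =>
    rw [fixSum_add_three, h0, h1]
    simp only [nsmul_eq_mul]
    push_cast
    ring

lemma fixSum_natCast (m : ℕ) : fixSum (m + 1) (fun k => (k : ℝ)) =
    (2 ^ (m + 1) * (3 * (m + 1) + 4) - 4 * (-1) ^ (m + 1)) / 18 := by
  induction m using Nat.twoStepInduction with
  | zero => norm_num [fixSum_one]
  | one => norm_num [fixSum_two]
  | more m h0 h1 =>
    have h : fixSum (m + 2) (fun k => ((k + 1 : ℕ) : ℝ)) =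
        fixSum (m + 2) (fun k => (k : ℝ)) + fixSum (m + 2) (fun _ => (1 : ℝ)) := by
      simp only [fixSum, ← Finset.sum_add_distrib, Nat.cast_add, Nat.cast_one]
    rw [fixSum_add_three, h, h0, h1, fixSum_const_one]
    simp only [nsmul_eq_mul]
    push_cast
    ring

lemma fixSum_natCast_sq (m : ℕ) : fixSum (m + 1) (fun k => (k : ℝ) ^ 2) =
    (2 ^ (m + 1) * (6 * (m + 1) ^ 2 + 32 * (m + 1) + 16) + (-1) ^ (m + 1) * (16 * m)) / 108 := by
  induction m using Nat.twoStepInduction with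
  | zero => norm_num [fixSum_one]
  | one => norm_num [fixSum_two]
  | more m h0 h1 =>
    have h : fixSum (m + 2) (fun k => ((k + 1 : ℕ) : ℝ) ^ 2) =
        fixSum (m + 2) (fun k => (k : ℝ) ^ 2) + 2 * fixSum (m + 2) (fun k => (k : ℝ)) +
          fixSum (m + 2) (fun _ => (1 : ℝ)) := by
      simp only [fixSum, Finset.mul_sum, ← Finset.sum_add_distrib]
      refine Finset.sum_congr rfl fun p _ => ?_
      push_cast
      ring
    rw [fixSum_add_three, h, h0, h1, fixSum_natCast, fixSum_const_one]
    simp only [nsmul_eq_mul]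
    push_cast
    ring

/-! ### Mean and variance under the uniform law -/

lemma integral_uniformOn {α E : Type*} [Fintype α] [MeasurableSpace α]
    [MeasurableSingletonClass α] [NormedAddCommGroup E] [NormedSpace ℝ E]
    [CompleteSpace E] (S : Finset α)
    (f : α → E) :
    ∫ x, f x ∂(uniformOn (S : Set α)) = (S.card : ℝ)⁻¹ • ∑ x ∈ S, f x := by
  classical
  rw [integral_fintype (Integrable.of_finite)]
  have h : ∀ x, (uniformOn (S : Set α)).real {x} = if x ∈ S then (S.card : ℝ)⁻¹ else 0 := by
    intro x
    rw [measureReal_def, ← Finset.coe_singleton, uniformOn_apply_finset]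
    by_cases hx : x ∈ S
    · simp [hx]
    · simp [hx]
  simp only [h, ite_smul, zero_smul, Finset.sum_ite_mem, Finset.univ_inter, Finset.smul_sum]

section law

variable {τ : Equiv.Perm (Fin 3)} {Ω : Type*} [MeasurableSpace Ω] {P : Measure Ω}
  {n : ℕ} {X : Ω → Equiv.Perm (Fin n)}

lemma integral_comp_numFixedPoints (hτ : τ = perm231 ∨ τ = perm312)
    (hX : HasLaw X (uniformOn (avoidingInvolutions τ n)) P)
    {E : Type*} [NormedAddCommGroup E] [NormedSpace ℝ E]
    [CompleteSpace E] (g : ℕ → E) :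
    ∫ ω, g (numFixedPoints (X ω)) ∂P = ((2 : ℝ) ^ (n - 1))⁻¹ • fixSum n g := by
  have h := hX.integral_comp (f := fun π => g (numFixedPoints π)) .of_discrete
  simp only [Function.comp_def] at h
  have hS := integral_uniformOn (Set.toFinite (avoidingInvolutions τ n)).toFinset
    fun π => g (numFixedPoints π)
  rw [Set.Finite.coe_toFinset] at hS
  rw [h, hS, sum_avoidingInvolutions hτ]
  have hc := sum_avoidingInvolutions hτ n fun _ => (1 : ℝ)
  rw [Finset.sum_const, nsmul_eq_mul, mul_one] at hc
  rw [hc]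
  cases n with
  -- Truncated subtraction makes `2 ^ (0 - 1) = 1`, the correct count for the empty permutation.
  | zero => simp [fixSum_zero]
  | succ m => rw [fixSum_const_one, Nat.add_sub_cancel]

lemma aemeasurable_comp_perm (hX : HasLaw X (uniformOn (avoidingInvolutions τ n)) P)
    {E : Type*} [MeasurableSpace E] (g : Equiv.Perm (Fin n) → E) :
    AEMeasurable (fun ω => g (X ω)) P :=
  (Measurable.of_discrete (f := g)).comp_aemeasurable hX.aemeasurable

lemma abs_neg_one_pow_div_two_pow_mul_le (m : ℕ) :
    |(-1 : ℝ) ^ (m + 1) / 2 ^ m| * (m + 1) ≤ 1 := by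
  rw [abs_div, abs_pow, abs_neg, abs_one, one_pow, abs_of_pos (by positivity : (0 : ℝ) < 2 ^ m),
    one_div, inv_mul_le_iff₀ (by positivity), mul_one]
  exact_mod_cast Nat.lt_two_pow_self

lemma integral_numFixedPoints_succ {m : ℕ} {X : Ω → Equiv.Perm (Fin (m + 1))}
    (hτ : τ = perm231 ∨ τ = perm312)
    (hX : HasLaw X (uniformOn (avoidingInvolutions τ (m + 1))) P) :
    ∫ ω, (numFixedPoints (X ω) : ℝ) ∂P =
      ((m : ℝ) + 1) / 3 + 4 / 9 - 2 / 9 * ((-1) ^ (m + 1) / 2 ^ m) := by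
  rw [integral_comp_numFixedPoints hτ hX (fun k => (k : ℝ)), fixSum_natCast, Nat.add_sub_cancel,
    smul_eq_mul]
  field_simp
  ring

lemma integral_numFixedPoints_sq_succ {m : ℕ} {X : Ω → Equiv.Perm (Fin (m + 1))}
    (hτ : τ = perm231 ∨ τ = perm312)
    (hX : HasLaw X (uniformOn (avoidingInvolutions τ (m + 1))) P) :
    ∫ ω, (numFixedPoints (X ω) : ℝ) ^ 2 ∂P =
      ((m : ℝ) + 1) ^ 2 / 9 + 16 / 27 * (m + 1) + 8 / 27 +
        4 / 27 * m * ((-1) ^ (m + 1) / 2 ^ m) := by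
  rw [integral_comp_numFixedPoints hτ hX (fun k => (k : ℝ) ^ 2), fixSum_natCast_sq,
    Nat.add_sub_cancel, smul_eq_mul]
  field_simp
  ring

lemma abs_integral_numFixedPoints_sub_le (hτ : τ = perm231 ∨ τ = perm312)
    (hX : HasLaw X (uniformOn (avoidingInvolutions τ n)) P) :
    |(∫ ω, (numFixedPoints (X ω) : ℝ) ∂P) - (n : ℝ) / 3| ≤ 1 := by
  cases n with
  | zero => simp [numFixedPoints]
  | succ m =>
    rw [integral_numFixedPoints_succ hτ hX]
    have h1 := abs_neg_one_pow_div_two_pow_mul_le m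
    set w : ℝ := (-1) ^ (m + 1) / 2 ^ m
    have h2 : |w| ≤ 1 := by
      nlinarith [mul_nonneg (abs_nonneg w) (Nat.cast_nonneg (α := ℝ) m)]
    push_cast
    rw [abs_le] at h2 ⊢
    constructor <;> linarith

lemma abs_variance_numFixedPoints_sub_le [IsProbabilityMeasure P]
    (hτ : τ = perm231 ∨ τ = perm312)
    (hX : HasLaw X (uniformOn (avoidingInvolutions τ n)) P) :
    |variance (fun ω => (numFixedPoints (X ω) : ℝ)) P - 8 * (n : ℝ) / 27| ≤ 1 := by
  have hmem : MemLp (fun ω => (numFixedPoints (X ω) : ℝ)) 2 P := by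
    refine MemLp.of_bound (aemeasurable_comp_perm hX
      fun π => (numFixedPoints π : ℝ)).aestronglyMeasurable n (Eventually.of_forall fun ω => ?_)
    rw [Real.norm_natCast, Nat.cast_le]
    exact (Finset.card_filter_le _ _).trans (by simp)
  rw [variance_eq_sub hmem]
  simp only [Pi.pow_apply]
  cases n with
  | zero => simp [numFixedPoints]
  | succ m =>
    rw [integral_numFixedPoints_succ hτ hX, integral_numFixedPoints_sq_succ hτ hX]
    have h1 := abs_neg_one_pow_div_two_pow_mul_le m
    set w : ℝ := (-1) ^ (m + 1) / 2 ^ m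
    have h2 : |w| ≤ 1 := by
      nlinarith [mul_nonneg (abs_nonneg w) (Nat.cast_nonneg (α := ℝ) m)]
    have h3 : |w * (m + 1)| ≤ 1 := by
      rwa [abs_mul, abs_of_pos (by positivity : (0 : ℝ) < m + 1)]
    have h4 : w ^ 2 ≤ 1 := (sq_le_one_iff_abs_le_one w).2 h2
    have h5 := sq_nonneg w
    push_cast
    -- The quadratic terms cancel, and the linear coefficient is `16/27 - 2 · (1/3) · (4/9) = 8/27`;
    -- what remains is bounded since `w` decays exponentially.
    rw [show ((m : ℝ) + 1) ^ 2 / 9 + 16 / 27 * (m + 1) + 8 / 27 + 4 / 27 * m * w -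
      (((m : ℝ) + 1) / 3 + 4 / 9 - 2 / 9 * w) ^ 2 - 8 * ((m : ℝ) + 1) / 27 =
      8 / 81 + 8 / 27 * (w * (m + 1)) + 4 / 81 * w - 4 / 81 * w ^ 2 by ring]
    rw [abs_le] at h2 h3 ⊢
    constructor <;> linarith

end law

/-! ### The dominant characteristic root near `s = 0` -/

open Complex Topology in
/-- A root `r` of `r ^ 2 = x * r + 2` at `x = exp (s * I)`, with value `2` at `s = 0`. -/
noncomputable def dominantRoot (s : ℝ) : ℂ :=
  (exp (s * I) + (exp (s * I) ^ 2 + 8) ^ (1 / 2 : ℂ)) / 2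

section root

open Complex Topology

lemma dominantRoot_sq (s : ℝ) :
    dominantRoot s ^ 2 = exp (s * I) * dominantRoot s + 2 := by
  have h : ((exp (s * I) ^ 2 + 8) ^ (1 / 2 : ℂ)) ^ 2 = exp (s * I) ^ 2 + 8 := by
    rw [one_div]
    exact cpow_nat_inv_pow _ two_ne_zero
  simp only [dominantRoot]
  linear_combination h / 4

lemma dominantRoot_zero : dominantRoot 0 = 2 := by
  have h : ((9 : ℂ)) ^ (1 / 2 : ℂ) = 3 := by
    rw [show (9 : ℂ) = 3 ^ 2 by norm_num, one_div]
    exact pow_cpow_nat_inv two_ne_zero (by simp [Real.pi_pos]) (by simp; positivity)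
  simp only [dominantRoot, ofReal_zero, zero_mul, exp_zero]
  norm_num [h]

lemma continuousAt_dominantRoot : ContinuousAt dominantRoot 0 := by
  have h : ContinuousAt (fun s : ℝ => (exp (s * I) ^ 2 + 8) ^ (1 / 2 : ℂ)) 0 := by
    refine ContinuousAt.cpow (by fun_prop) continuousAt_const ?_
    left
    norm_num
  unfold dominantRoot
  fun_prop

/-- Using `Real.sinc` extracts the factor `s ^ 2` exactly, with a cofactor continuous at 0. -/
lemma two_mul_cos_sub_two (s : ℝ) :
    exp (((2 * s / 3 : ℝ) : ℂ) * I) + exp (-((2 * s / 3 : ℝ) : ℂ) * I) - 2 =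
      -(4 / 9) * s ^ 2 * (Real.sinc (s / 3) : ℂ) ^ 2 := by
  have h1 : Real.sin (s / 3) = s / 3 * Real.sinc (s / 3) := by
    rcases eq_or_ne s 0 with rfl | hs
    · simp
    · rw [Real.sinc_of_ne_zero (by positivity)]
      field_simp
  have h2 : 2 * Real.cos (2 * s / 3) - 2 = -(4 / 9) * s ^ 2 * Real.sinc (s / 3) ^ 2 := by
    rw [show 2 * s / 3 = 2 * (s / 3) by ring, Real.cos_two_mul, Real.cos_sq', h1]
    ring
  rw [← two_cos, ← ofReal_cos]
  have h3 := congrArg (fun r : ℝ => (r : ℂ)) h2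
  push_cast at h3 ⊢
  exact h3

/-- The dominant root, centred and normalized. -/
noncomputable def normalizedRoot (s : ℝ) : ℂ := dominantRoot s * exp (-(s / 3 : ℂ) * I) / 2

lemma continuousAt_normalizedRoot : ContinuousAt normalizedRoot 0 := by
  have := continuousAt_dominantRoot
  unfold normalizedRoot
  fun_prop

lemma normalizedRoot_zero : normalizedRoot 0 = 1 := by
  simp [normalizedRoot, dominantRoot_zero]

/-- With `a = exp (s * I / 3)`, the root `y = normalizedRoot s` satisfies `2 y² = a² y + a⁻²`; this
is that equation expanded about `y = 1`. The centring makes the right side `O(s²)`, while the second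
factor tends to 3, whence the constant `-(4/9)/3 = -4/27`. -/
lemma normalizedRoot_sub_one_mul (s : ℝ) :
    (normalizedRoot s - 1) *
      (4 - exp (((2 * s / 3 : ℝ) : ℂ) * I) + 2 * (normalizedRoot s - 1)) =
      -(4 / 9) * s ^ 2 * (Real.sinc (s / 3) : ℂ) ^ 2 := by
  rw [← two_mul_cos_sub_two]
  set a := exp ((s / 3 : ℂ) * I) with ha
  set b := exp (-(s / 3 : ℂ) * I) with hb
  have hab : a * b = 1 := by
    rw [ha, hb, ← exp_add]
    simp
  have hx : exp (s * I) = a ^ 3 := by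
    rw [ha, ← exp_nat_mul]
    congr 1
    push_cast
    ring
  have hy : exp (((2 * s / 3 : ℝ) : ℂ) * I) = a ^ 2 := by
    rw [ha, ← exp_nat_mul]
    congr 1
    push_cast
    ring
  have hz : exp (-((2 * s / 3 : ℝ) : ℂ) * I) = b ^ 2 := by
    rw [hb, ← exp_nat_mul]
    congr 1
    push_cast
    ring
  have hr := dominantRoot_sq s
  rw [hx] at hr
  rw [hy, hz]
  simp only [normalizedRoot, ← hb]
  linear_combination (b ^ 2 / 2) * hr + (a ^ 2 * dominantRoot s * b / 2) * hab

lemma exists_normalizedRoot_sub_one_eq :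
    ∃ R : ℝ → ℂ, Tendsto R (𝓝 0) (𝓝 (-(4 / 27))) ∧
      ∀ᶠ s in 𝓝 0, normalizedRoot s - 1 = s ^ 2 * R s := by
  let D : ℝ → ℂ := fun s =>
    4 - exp (((2 * s / 3 : ℝ) : ℂ) * I) + 2 * (normalizedRoot s - 1)
  have hn := continuousAt_normalizedRoot
  have hD : ContinuousAt D 0 := by fun_prop
  have hD0 : D 0 = 3 := by
    simp only [D, normalizedRoot_zero]
    norm_num
  have hD0' : D 0 ≠ 0 := by rw [hD0]; norm_num
  refine ⟨fun s => -(4 / 9) * (Real.sinc (s / 3) : ℂ) ^ 2 / D s, ?_, ?_⟩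
  · have hs : ContinuousAt (fun s : ℝ => (Real.sinc (s / 3) : ℂ)) 0 := by
      have := Real.continuous_sinc
      fun_prop
    have h : ContinuousAt (fun s : ℝ => -(4 / 9) * (Real.sinc (s / 3) : ℂ) ^ 2 / D s) 0 := by
      fun_prop (disch := assumption)
    have h' := h.tendsto
    rw [hD0] at h'
    convert h' using 2
    norm_num
  · filter_upwards [hD.eventually_ne hD0'] with s hs
    have := normalizedRoot_sub_one_mul s
    field_simp
    linear_combination 9 * this

/-! ### Binet formula and asymptotics of the generating function -/

lemma sub_mul_fixSum_pow {R : Type*} [CommRing R] {x l u : R} (hs : l + u = x) (hp : l * u = -2)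
    (m : ℕ) :
    (l - u) * fixSum (m + 1) (fun k => x ^ k) =
      l ^ m * (l * x + 1) - u ^ m * (u * x + 1) := by
  subst hs
  induction m using Nat.twoStepInduction with
  | zero => simp [fixSum_one]; ring
  | one => simp [fixSum_two]; ring
  | more m h0 h1 =>
    have h : fixSum (m + 2) (fun k => (l + u) ^ (k + 1)) =
        (l + u) * fixSum (m + 2) (fun k => (l + u) ^ k) := by
      simp only [fixSum, Finset.mul_sum, pow_succ']
    rw [fixSum_add_three, h, two_nsmul]
    linear_combination (l + u) * h1 + 2 * h0 +
      (l ^ m * (l * (l + u) + 1) - u ^ m * (u * (l + u) + 1)) * hp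

lemma tendsto_pow_zero_of_tendsto {z : ℕ → ℂ} {c : ℂ} (hz : Tendsto z atTop (𝓝 c))
    (hc : ‖c‖ < 1) : Tendsto (fun n => z n ^ n) atTop (𝓝 0) := by
  obtain ⟨r, hcr, hr⟩ := exists_between hc
  refine squeeze_zero_norm' ?_
    (tendsto_pow_atTop_nhds_zero_of_lt_one ((norm_nonneg c).trans hcr.le) hr)
  filter_upwards [hz.norm.eventually_lt_const hcr] with n hn
  rw [norm_pow]
  exact pow_le_pow_left₀ (norm_nonneg _) hn.le n

lemma tendsto_normalizedRoot_pow {s : ℕ → ℝ} {c : ℝ} (hs : Tendsto s atTop (𝓝 0))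
    (hc : Tendsto (fun n : ℕ => n * s n ^ 2) atTop (𝓝 c)) :
    Tendsto (fun n => normalizedRoot (s n) ^ n) atTop (𝓝 (exp (-(4 / 27) * c))) := by
  obtain ⟨R, hR, hR'⟩ := exists_normalizedRoot_sub_one_eq
  have h : Tendsto (fun n : ℕ => (n : ℂ) * (normalizedRoot (s n) - 1)) atTop
      (𝓝 (-(4 / 27) * c)) := by
    have h1 : Tendsto (fun n : ℕ => ((n * s n ^ 2 : ℝ) : ℂ)) atTop (𝓝 c) :=
      (continuous_ofReal.tendsto c).comp hc
    refine ((hR.comp hs).mul h1).congr' ?_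
    filter_upwards [hs.eventually hR'] with n hn
    rw [hn]
    simp only [Function.comp_apply]
    push_cast
    ring
  simpa using tendsto_one_add_pow_exp_of_tendsto h

/-- Asymptotics of the centred generating function of the number of fixed points. -/
lemma tendsto_fixSum_exp {s : ℕ → ℝ} {c : ℝ} (hs : Tendsto s atTop (𝓝 0))
    (hc : Tendsto (fun n : ℕ => n * s n ^ 2) atTop (𝓝 c)) :
    Tendsto (fun n : ℕ => exp (-(n * s n / 3 : ℂ) * I) *
      (((2 : ℂ) ^ (n - 1))⁻¹ * fixSum n (fun k => exp (s n * I) ^ k))) atTop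
      (𝓝 (exp (-(4 / 27) * c))) := by
  -- The second characteristic root, by Vieta. Halved and centred it is near `-1/2`, so its `n`-th
  -- power vanishes, and only the dominant root contributes, with amplitude tending to `3 / 3 = 1`.
  let u : ℝ → ℂ := fun r => exp (r * I) - dominantRoot r
  have hl := continuousAt_dominantRoot
  have hu : ContinuousAt u 0 := by fun_prop
  have hu0 : u 0 = -1 := by norm_num [u, dominantRoot_zero]
  have hd : Tendsto (fun n => dominantRoot (s n) - u (s n)) atTop (𝓝 3) := by
    have := (hl.sub hu).tendsto.comp hs
    rw [Pi.sub_apply, dominantRoot_zero, hu0] at this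
    norm_num at this
    exact this
  have hA : Tendsto (fun n => 2 * (dominantRoot (s n) * exp (s n * I) + 1) / dominantRoot (s n))
      atTop (𝓝 3) := by
    have h0 : dominantRoot 0 ≠ 0 := by rw [dominantRoot_zero]; norm_num
    have : ContinuousAt
        (fun r => 2 * (dominantRoot r * exp (r * I) + 1) / dominantRoot r) 0 := by
      fun_prop (disch := assumption)
    have := this.tendsto.comp hs
    simp only [dominantRoot_zero] at this
    norm_num at this
    exact this
  have hB : Tendsto (fun n => u (s n) * exp (s n * I) + 1) atTop (𝓝 0) := by
    have : ContinuousAt (fun r => u r * exp (r * I) + 1) 0 := by fun_prop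
    have := this.tendsto.comp hs
    simp only [hu0] at this
    norm_num at this
    exact this
  have hw : Tendsto (fun n => (u (s n) / 2 * exp (-(s n / 3 : ℂ) * I)) ^ n) atTop (𝓝 0) := by
    refine tendsto_pow_zero_of_tendsto (c := -1 / 2) ?_ (by norm_num)
    have : ContinuousAt (fun r : ℝ => u r / 2 * exp (-(r / 3 : ℂ) * I)) 0 := by fun_prop
    have := this.tendsto.comp hs
    simp only [hu0] at this
    norm_num at this
    norm_num
    exact this
  have hu1 : Tendsto (fun n => 2 / u (s n)) atTop (𝓝 (-2)) := by
    have h0 : u 0 ≠ 0 := by rw [hu0]; norm_num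
    have : ContinuousAt (fun r : ℝ => 2 / u r) 0 := by fun_prop (disch := assumption)
    have := this.tendsto.comp hs
    simp only [hu0] at this
    norm_num at this
    exact this
  have key := (((tendsto_normalizedRoot_pow hs hc).mul hA).sub
    ((hw.mul hu1).mul hB)).div hd (by norm_num)
  rw [mul_zero, sub_zero, mul_div_cancel_right₀ _ (by norm_num)] at key
  refine key.congr' ?_
  filter_upwards [eventually_ge_atTop 1, hd.eventually_ne (by norm_num : (3 : ℂ) ≠ 0)] with n hn hne
  obtain ⟨m, rfl⟩ := Nat.exists_eq_add_of_le' hn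
  have hprod : dominantRoot (s (m + 1)) * u (s (m + 1)) = -2 := by
    linear_combination -dominantRoot_sq (s (m + 1))
  have hF := sub_mul_fixSum_pow (x := exp (s (m + 1) * I)) (l := dominantRoot (s (m + 1)))
    (u := u (s (m + 1))) (add_sub_cancel _ _) hprod m
  have hl0 : dominantRoot (s (m + 1)) ≠ 0 := fun h => by simp [h] at hprod
  have hu0' : u (s (m + 1)) ≠ 0 := fun h => by simp [h] at hprod
  have hexp : exp (-((m + 1 : ℕ) * s (m + 1) / 3 : ℂ) * I) =
      exp (-(s (m + 1) / 3 : ℂ) * I) ^ (m + 1) := by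
    rw [← exp_nat_mul]
    congr 1
    ring
  have hbF : ∀ b : ℂ, b * ((2 : ℂ) ^ m)⁻¹ * (dominantRoot (s (m + 1)) ^ m *
      (dominantRoot (s (m + 1)) * exp (s (m + 1) * I) + 1) -
        u (s (m + 1)) ^ m * (u (s (m + 1)) * exp (s (m + 1) * I) + 1)) =
      b * (((2 : ℂ) ^ m)⁻¹ * fixSum (m + 1) fun k => exp (s (m + 1) * I) ^ k) *
        (dominantRoot (s (m + 1)) - u (s (m + 1))) := fun b => by
    rw [← hF]
    ring
  rw [hexp, Nat.add_sub_cancel, Pi.div_apply, div_eq_iff hne, ← hbF]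
  simp only [normalizedRoot, mul_pow, div_pow, pow_succ]
  field_simp

end root

/-! ### Central limit theorem -/

lemma tendsto_charFun_numFixedPoints {τ : Equiv.Perm (Fin 3)} (hτ : τ = perm231 ∨ τ = perm312)
    {Ω : ℕ → Type*} [∀ n, MeasurableSpace (Ω n)] (P : ∀ n, Measure (Ω n))
    (X : ∀ n, Ω n → Equiv.Perm (Fin n))
    (hX : ∀ n, HasLaw (X n) (uniformOn (avoidingInvolutions τ n)) (P n)) (t : ℝ) :
    Tendsto (fun n : ℕ => charFun ((P n).map fun ω =>
      ((numFixedPoints (X n ω) : ℝ) - (n : ℝ) / 3) / Real.sqrt (8 * (n : ℝ) / 27)) t) atTop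
      (nhds (charFun (gaussianReal 0 1) t)) := by
  let s : ℕ → ℝ := fun n => t / Real.sqrt (8 * (n : ℝ) / 27)
  have hs : Tendsto s atTop (nhds 0) := by
    refine Tendsto.const_div_atTop (Real.tendsto_sqrt_atTop.comp ?_) t
    have : Tendsto (fun n : ℕ => (n : ℝ) * (8 / 27)) atTop atTop :=
      tendsto_natCast_atTop_atTop.atTop_mul_const (by norm_num)
    exact this.congr fun n => by ring
  -- The variance constant enters here: `(4/27) · (27/8) t² = t²/2`, the standard Gaussian exponent.
  have hc : Tendsto (fun n : ℕ => n * s n ^ 2) atTop (nhds (27 / 8 * t ^ 2)) := by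
    refine tendsto_const_nhds.congr' ?_
    filter_upwards [eventually_ge_atTop 1] with n hn
    have : (0 : ℝ) < n := by exact_mod_cast hn
    simp only [s]
    rw [div_pow, Real.sq_sqrt (by positivity)]
    field_simp
  have key := tendsto_fixSum_exp hs hc
  have hlim : Complex.exp (-(4 / 27) * ((27 / 8 * t ^ 2 : ℝ) : ℂ)) =
      charFun (gaussianReal 0 1) t := by
    rw [charFun_gaussianReal]
    congr 1
    push_cast
    ring
  rw [hlim] at key
  refine key.congr fun n => ?_
  have hm := aemeasurable_comp_perm (hX n)
    fun π => ((numFixedPoints π : ℝ) - (n : ℝ) / 3) / Real.sqrt (8 * (n : ℝ) / 27)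
  rw [charFun_apply_real, integral_map hm (by fun_prop)]
  have hg := integral_comp_numFixedPoints hτ (hX n) fun k => Complex.exp (s n * Complex.I) ^ k
  rw [Complex.real_smul] at hg
  push_cast at hg
  rw [← hg, ← integral_const_mul]
  refine integral_congr_ae (Eventually.of_forall fun ω => ?_)
  simp only [← Complex.exp_nat_mul, ← Complex.exp_add, s]
  congr 1
  push_cast
  ring

theorem theorem3
    (τ : Equiv.Perm (Fin 3)) (hτ : τ = perm231 ∨ τ = perm312)
    {Ω : ℕ → Type*} [∀ n, MeasurableSpace (Ω n)]
    (P : ∀ n, Measure (Ω n)) [∀ n, IsProbabilityMeasure (P n)]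
    (Perms : ∀ n, Ω n → Equiv.Perm (Fin n))
    (hPerms : ∀ n, HasLaw (Perms n) (uniformOn (avoidingInvolutions τ n)) (P n))
    {Ω' : Type*} [MeasurableSpace Ω'] (P' : Measure Ω') [IsProbabilityMeasure P']
    (Z : Ω' → ℝ) (hZ : HasLaw Z (gaussianReal 0 1) P') :
    (∃ C : ℝ, ∀ n : ℕ,
      |(∫ ω, (numFixedPoints (Perms n ω) : ℝ) ∂(P n)) - (n : ℝ) / 3| ≤ C) ∧
    (∃ C : ℝ, ∀ n : ℕ,
      |variance (fun ω => (numFixedPoints (Perms n ω) : ℝ)) (P n) - 8 * (n : ℝ) / 27| ≤ C) ∧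
    TendstoInDistribution
      (fun (n : ℕ) (ω : Ω n) =>
        ((numFixedPoints (Perms n ω) : ℝ) - (n : ℝ) / 3) / Real.sqrt (8 * (n : ℝ) / 27))
      atTop Z P P' := by
  refine ⟨⟨1, fun n => abs_integral_numFixedPoints_sub_le hτ (hPerms n)⟩,
    ⟨1, fun n => abs_variance_numFixedPoints_sub_le hτ (hPerms n)⟩, ?_⟩
  refine ⟨fun n => aemeasurable_comp_perm (hPerms n)
    fun π => ((numFixedPoints π : ℝ) - (n : ℝ) / 3) / Real.sqrt (8 * (n : ℝ) / 27),
    hZ.aemeasurable, ?_⟩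
  refine ProbabilityMeasure.tendsto_iff_tendsto_charFun.2 fun t => ?_
  simp only [ProbabilityMeasure.coe_mk, hZ.map_eq]
  exact tendsto_charFun_numFixedPoints hτ P Perms hPerms t
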